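/- Let $\Omega\subset\mathbb R^N$ be a domain and let $A=\partial_h(\mathscr A^{hk}(x)\,\partial_k)$ (summation over repeated indices, $1\le h,k\le N$), where $\mathscr A^{hk}=\{a^{hk}_{ij}\}$ are $m\times m$ matrices with complex-valued entries in $L^\infty(\Omega)$. Let $\varphi:(0,\infty)\to(0,\infty)$ satisfy: (i) $\varphi\in C^1((0,\infty))$; (ii) $(s\varphi(s))'>0$ for all $s>0$; (iii) the range of $s\mapsto s\varphi(s)$ is $(0,\infty)$; (iv) there are $C_1,C_2,s_0>0$ and $r>-1$ with $C_1s^r\le (s\varphi(s))'\le C_2s^r$ for $s\in(0,s_0)$; if $r=0$, moreover $\lim_{s\to0^+}\varphi(s)$ exists, is finite and positive, and $\lim_{s\to0^+}s\varphi'(s)=0$; (v) there is $s_1>s_0$ such that either $\varphi'(s)\ge0$ for all $s\ge s_1$, or $\varphi'(s)\le0$ for all $s\ge s_1$. Put $\Phi(s)=\int_0^s\sigma\varphi(\sigma)\,d\sigma$, let $\zeta$ be the inverse of $s\mapsto s\sqrt{\varphi(s)}$ on $(0,\infty)$, and set $\Theta(t)=\zeta(t)/t$ and $\Lambda(t)=t\,\Theta'(t)/\Theta(t)$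 for $t>0$. Let $\mathring H^1(\Omega)$ be the closure of $C_0^\infty(\Omega)$ in the $H^1$ norm, and read $\varphi(|u|)u$ and $\sqrt{\varphi(|u|)}\,u$ as $0$ where $u=0$. The operator $A$ is called $L^\Phi$-dissipative if $$\operatorname{Re}\int_\Omega\langle\mathscr A^{hk}\partial_k u,\partial_h(\varphi(|u|)u)\rangle\,dx\ \ge 0$$ for all $u\in[\mathring H^1(\Omega)]^m$ with $\varphi(|u|)u\in[\mathring H^1(\Omega)]^m$, and strictly $L^\Phi$-dissipative if there is $\kappa>0$ such that, for all such $u$, $\sqrt{\varphi(|u|)}\,u$ belongs to $[H^1(\Omega)]^m$ and $$\operatorname{Re}\int_\Omega\langle\mathscr A^{hk}\partial_k u,\partial_h(\varphi(|u|)u)\rangle\,dx\ \ge\ \kappa\int_\Omega|\nabla(\sqrt{\varphi(|u|)}\,u)|^2\,dx .$$ By $A-\kappa\Delta$ we mean the operator with coefficients $a^{hk}_{ij}-\kappa\,\delta_{hk}\delta_{ij}$. If $\sup_{t>0}\Lambda^2(t)<1$, then $A$ is strictly $L^\Phi$-dissipative if and only if there exists $\kappa>0$ such that $A-\kappa\Delta$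 is $L^\Phi$-dissipative. In particular, for every $1<p<\infty$ (the case $\varphi(s)=s^{p-2}$, in which one speaks of $L^p$-dissipativity, and of $p$-ellipticity instead of strict $L^p$-dissipativity), $A$ is strictly $L^p$-dissipative if and only if there exists $\kappa>0$ such that $A-\kappa\Delta$ is $L^p$-dissipative. -/

import Mathlib

open MeasureTheory

namespace FunctionalDissipativity

/-- The Euclidean space `ℝ^N`. -/
abbrev RSpace (N : ℕ) : Type := EuclideanSpace ℝ (Fin N)

/-- The space `ℂ^m` with its Hermitian norm. -/
abbrev CSpace (m : ℕ) : Type := EuclideanSpace ℂ (Fin m)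

/-- The partial derivative `∂_k f` of a differentiable function `f` on `ℝ^N`. -/
noncomputable def partialDeriv {N : ℕ} {F : Type*} [NormedAddCommGroup F] [NormedSpace ℝ F]
    (k : Fin N) (f : RSpace N → F) (x : RSpace N) : F :=
  fderiv ℝ f x (EuclideanSpace.single k (1 : ℝ))

/-- Smooth functions on `ℝ^N` whose support is a compact subset of `Ω`. -/
structure IsTestFunction {N : ℕ} {F : Type*} [NormedAddCommGroup F] [NormedSpace ℝ F]
    (Ω : Set (RSpace N)) (f : RSpace N → F) : Prop where
  smooth : ContDiff ℝ ((⊤ : ℕ∞) : WithTop ℕ∞) f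
  compactSupport : HasCompactSupport f
  support_subset : tsupport f ⊆ Ω

/-- `Du = (∂_1 u, …, ∂_N u)` is the weak gradient of the `ℂ^m`-valued function `u` in `Ω`. -/
structure HasWeakGradient {N m : ℕ} (Ω : Set (RSpace N)) (u : RSpace N → CSpace m)
    (Du : Fin N → RSpace N → CSpace m) : Prop where
  locInt : LocallyIntegrableOn u Ω volume
  locInt_grad : ∀ k, LocallyIntegrableOn (Du k) Ω volume
  integral_eq : ∀ η : RSpace N → ℝ, IsTestFunction Ω η → ∀ k,
    ∫ x in Ω, partialDeriv k η x • u x = - ∫ x in Ω, η x • Du k x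

/-- `u` belongs to `[H¹(Ω)]^m` and `Du` is its weak gradient. -/
structure IsH1 {N m : ℕ} (Ω : Set (RSpace N)) (u : RSpace N → CSpace m)
    (Du : Fin N → RSpace N → CSpace m) : Prop where
  memLp : MemLp u 2 (volume.restrict Ω)
  memLp_grad : ∀ k, MemLp (Du k) 2 (volume.restrict Ω)
  weakGradient : HasWeakGradient Ω u Du

/-- `u` belongs to `[H¹₀(Ω)]^m`, the closure of the `ℂ^m`-valued test functions in the
`H¹` norm, and `Du` is its weak gradient. -/
structure IsH10 {N m : ℕ} (Ω : Set (RSpace N)) (u : RSpace N → CSpace m)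
    (Du : Fin N → RSpace N → CSpace m) : Prop extends IsH1 Ω u Du where
  approx : ∀ ε : ENNReal, 0 < ε → ∃ f : RSpace N → CSpace m, IsTestFunction Ω f ∧
    eLpNorm (fun x => u x - f x) 2 (volume.restrict Ω) < ε ∧
    ∀ k, eLpNorm (fun x => Du k x - partialDeriv k f x) 2 (volume.restrict Ω) < ε

/-- The standing assumptions on the function `φ`; its value at `0` is irrelevant. -/
structure IsAdmissible (φ : ℝ → ℝ) : Prop where
  pos : ∀ s, 0 < s → 0 < φ s
  contDiffOn : ContDiffOn ℝ 1 φ (Set.Ioi 0)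
  deriv_pos : ∀ s, 0 < s → 0 < deriv (fun σ => σ * φ σ) s
  range_eq : (fun σ => σ * φ σ) '' Set.Ioi 0 = Set.Ioi 0
  behaviour : ∃ C₁ C₂ r s₀ s₁ : ℝ, 0 < C₁ ∧ 0 < C₂ ∧ -1 < r ∧ 0 < s₀ ∧ s₀ < s₁ ∧
    (∀ s ∈ Set.Ioo 0 s₀, C₁ * s ^ r ≤ deriv (fun σ => σ * φ σ) s ∧
      deriv (fun σ => σ * φ σ) s ≤ C₂ * s ^ r) ∧
    (r = 0 →
      (∃ φ₀ : ℝ, 0 < φ₀ ∧ Filter.Tendsto φ (nhdsWithin 0 (Set.Ioi 0)) (nhds φ₀)) ∧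
      Filter.Tendsto (fun s => s * deriv φ s) (nhdsWithin 0 (Set.Ioi 0)) (nhds 0)) ∧
    ((∀ s, s₁ ≤ s → 0 ≤ deriv φ s) ∨ (∀ s, s₁ ≤ s → deriv φ s ≤ 0))

/-- `ζ`, the inverse of the function `s ↦ s √φ(s)` on `(0, ∞)`. -/
noncomputable def zeta (φ : ℝ → ℝ) (t : ℝ) : ℝ :=
  Function.invFunOn (fun s => s * √(φ s)) (Set.Ioi 0) t

/-- `Θ(t) = ζ(t) / t`. -/
noncomputable def Theta (φ : ℝ → ℝ) (t : ℝ) : ℝ := zeta φ t / t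

/-- `Λ(t) = t Θ'(t) / Θ(t)`. -/
noncomputable def Lambda (φ : ℝ → ℝ) (t : ℝ) : ℝ := t * deriv (Theta φ) t / Theta φ t

/-- Coefficients of an operator `A = ∂_h (𝒜^{hk}(x) ∂_k)`: `a x h k i j` is the entry
`a^{hk}_{ij}(x)` of the `m × m` matrix `𝒜^{hk}(x)`. -/
abbrev Coefficients (N m : ℕ) : Type :=
  RSpace N → Fin N → Fin N → Matrix (Fin m) (Fin m) ℂ

/-- All entries of the coefficients belong to `L^∞(Ω)`. -/
def Coefficients.IsBounded {N m : ℕ} (Ω : Set (RSpace N)) (a : Coefficients N m) : Prop :=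
  ∀ h k i j, MemLp (fun x => a x h k i j) ⊤ (volume.restrict Ω)

/-- The coefficients `δ_{hk} δ_{ij}` of the Laplacian. -/
def laplacian (N m : ℕ) : Coefficients N m := fun _ h k => if h = k then 1 else 0

/-- The form `Re ∫_Ω ⟨𝒜^{hk} ∂_k u, ∂_h w⟩ dx` in terms of the gradients of `u` and `w`. -/
noncomputable def form {N m : ℕ} (Ω : Set (RSpace N)) (a : Coefficients N m)
    (Du Dw : Fin N → RSpace N → CSpace m) : ℝ :=
  (∫ x in Ω, ∑ h, ∑ k, ∑ i, ∑ j,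
    a x h k i j * Du k x j * (starRingEnd ℂ) (Dw h x i)).re

/-- `L^Φ`-dissipativity in `Ω` of the operator with coefficients `a`. -/
def IsDissipative {N m : ℕ} (Ω : Set (RSpace N)) (φ : ℝ → ℝ) (a : Coefficients N m) : Prop :=
  ∀ (u : RSpace N → CSpace m) (Du Dw : Fin N → RSpace N → CSpace m),
    IsH10 Ω u Du → IsH10 Ω (fun x => φ ‖u x‖ • u x) Dw → 0 ≤ form Ω a Du Dw

/-- Strict `L^Φ`-dissipativity in `Ω` of the operator with coefficients `a`. The weak gradient
`Dv` of `√φ(|u|) u` is unique up to null sets; the right-hand side of the inequality is meant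
to exist and to be finite. -/
def IsStrictlyDissipative {N m : ℕ} (Ω : Set (RSpace N)) (φ : ℝ → ℝ)
    (a : Coefficients N m) : Prop :=
  ∃ κ : ℝ, 0 < κ ∧
    ∀ (u : RSpace N → CSpace m) (Du Dw : Fin N → RSpace N → CSpace m),
      IsH10 Ω u Du → IsH10 Ω (fun x => φ ‖u x‖ • u x) Dw →
        ∃ Dv : Fin N → RSpace N → CSpace m,
          IsH1 Ω (fun x => √(φ ‖u x‖) • u x) Dv ∧
          κ * ∫ x in Ω, ∑ k, ‖Dv k x‖ ^ 2 ≤ form Ω a Du Dw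

end FunctionalDissipativity

open MeasureTheory

namespace FunctionalDissipativity

open Filter Topology

/-! Write `w = φ(|u|)u` and `v = √φ(|u|)u`. Passing from `A` to `A - κΔ` subtracts `κ ∫ ∑ Re⟨∂_k u,
∂_k w⟩` from the form, so it suffices to compare this integrand with `∑ |∂_k v|²`, up to constants.

The comparison is pointwise. Put `s = |u|`, `ξ = ∂_k u`, and let `b` be the component of `ξ` along
`u/|u|`. Then `Re⟨∂_k u, ∂_k w⟩ = φ(|ξ|² - b²) + (φ + sφ')b²`, while `|∂_k v|² = φ(|ξ|² - b²) + (2φ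
+ sφ')²/(4φ) b²`. The ratio of the two coefficients of `b²` is `1 - Λ²` at `t = s√φ(s)`. Hence the
first expression never exceeds the second (`inner_radialDeriv_le`), and it is at least `c = 1 - sup
Λ²` times the second (`le_inner_radialDeriv`).

The analytic work is to justify these gradient formulas when `φ` may be singular or degenerate at
`0` and the radial maps are not Lipschitz. Truncating them away from `0` and `∞` gives compactly
supported `C¹` maps, for which the chain rule follows by density (`hasWeakGradient_comp`). The
truncations are then removed by dominated convergence (`hasWeakGradient_of_trunc`). This identifies
`Dw` (`grad_radial_eq`) and places `v` in `H¹` (`isH1_sqrt`). -/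

variable {N m : ℕ} {Ω : Set (RSpace N)}

/-! ### Test functions and classical integration by parts. -/

section TestFunctions

variable {F : Type*} [NormedAddCommGroup F] [NormedSpace ℝ F]

theorem IsTestFunction.continuous {f : RSpace N → F} (hf : IsTestFunction Ω f) : Continuous f :=
  hf.smooth.continuous

theorem IsTestFunction.differentiable {f : RSpace N → F} (hf : IsTestFunction Ω f) :
    Differentiable ℝ f :=
  hf.smooth.differentiable (by simp)

theorem IsTestFunction.continuous_partialDeriv {f : RSpace N → F} (hf : IsTestFunction Ω f)
    (k : Fin N) : Continuous (partialDeriv k f) :=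
  (hf.smooth.continuous_fderiv (by simp)).clm_apply continuous_const

theorem IsTestFunction.hasCompactSupport_partialDeriv {f : RSpace N → F}
    (hf : IsTestFunction Ω f) (k : Fin N) : HasCompactSupport (partialDeriv k f) :=
  hf.compactSupport.fderiv_apply ℝ _

theorem IsTestFunction.eq_zero {f : RSpace N → F} (hf : IsTestFunction Ω f) {x : RSpace N}
    (hx : x ∉ Ω) : f x = 0 :=
  image_eq_zero_of_notMem_tsupport fun h => hx (hf.support_subset h)

theorem IsTestFunction.partialDeriv_eq_zero {f : RSpace N → F} (hf : IsTestFunction Ω f)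
    {x : RSpace N} (hx : x ∉ Ω) (k : Fin N) : partialDeriv k f x = 0 := by
  have : fderiv ℝ f x = 0 := image_eq_zero_of_notMem_tsupport fun h =>
    hx (hf.support_subset (tsupport_fderiv_subset ℝ h))
  simp [partialDeriv, this]

theorem IsTestFunction.memLp {f : RSpace N → F} (hf : IsTestFunction Ω f) (p : ENNReal) :
    MemLp f p (volume.restrict Ω) :=
  hf.continuous.memLp_of_hasCompactSupport hf.compactSupport

theorem IsTestFunction.memLp_partialDeriv {f : RSpace N → F} (hf : IsTestFunction Ω f)
    (k : Fin N) (p : ENNReal) : MemLp (partialDeriv k f) p (volume.restrict Ω) :=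
  (hf.continuous_partialDeriv k).memLp_of_hasCompactSupport (hf.hasCompactSupport_partialDeriv k)

theorem integral_partialDeriv_smul_comp {G : F → F} (hG : ContDiff ℝ 1 G)
    {f : RSpace N → F} (hf : IsTestFunction Ω f) {η : RSpace N → ℝ} (hη : IsTestFunction Ω η)
    (k : Fin N) :
    ∫ x in Ω, partialDeriv k η x • G (f x) =
      - ∫ x in Ω, η x • fderiv ℝ G (f x) (partialDeriv k f x) := by
  have hGf : ContDiff ℝ 1 (fun x => G (f x)) := hG.comp (hf.smooth.of_le (by simp))
  have hd : ∀ x, fderiv ℝ (fun x => G (f x)) x (EuclideanSpace.single k 1) =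
      fderiv ℝ G (f x) (partialDeriv k f x) := fun x => by
    rw [fderiv_fun_comp x (hG.differentiable (by simp) _) (hf.differentiable x)]
    rfl
  -- Both integrands vanish off `Ω` because `η` does, so the integration by parts takes place on the
  -- whole space and `∂Ω` plays no role.
  rw [setIntegral_eq_integral_of_forall_compl_eq_zero
      (fun x hx => by simp [hη.partialDeriv_eq_zero hx]),
    setIntegral_eq_integral_of_forall_compl_eq_zero (fun x hx => by simp [hη.eq_zero hx]),
    eq_neg_iff_add_eq_zero, add_comm, ← eq_neg_iff_add_eq_zero]
  have key := integral_smul_fderiv_eq_neg_fderiv_smul_of_integrable (μ := volume) (f := η)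
    (g := fun x => G (f x)) (v := EuclideanSpace.single k 1) ?_ ?_ ?_
    (fun x _ => hη.differentiable x) (fun x _ => hGf.differentiable (by simp) x)
  · simp only [hd] at key
    exact key
  · exact ((hη.continuous_partialDeriv k).smul hGf.continuous).integrable_of_hasCompactSupport
      (hη.hasCompactSupport_partialDeriv k).smul_right
  · exact (hη.continuous.smul ((hGf.continuous_fderiv (by simp)).clm_apply
      continuous_const)).integrable_of_hasCompactSupport hη.compactSupport.smul_right
  · exact (hη.continuous.smul hGf.continuous).integrable_of_hasCompactSupport
      hη.compactSupport.smul_right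

theorem IsTestFunction.integrableOn_smul {η : RSpace N → ℝ} (hη : IsTestFunction Ω η)
    {g : RSpace N → F} (hg : LocallyIntegrableOn g Ω volume) :
    IntegrableOn (fun x => η x • g x) Ω volume := by
  have h1 : IntegrableOn g (tsupport η) volume :=
    hg.integrableOn_compact_subset hη.support_subset hη.compactSupport
  have h2 : IntegrableOn (fun x => η x • g x) (tsupport η) volume :=
    h1.continuousOn_smul hη.continuous.continuousOn hη.compactSupport
  refine Integrable.integrableOn ?_
  rwa [integrableOn_iff_integrable_of_support_subset] at h2
  exact (Function.support_smul_subset_left η g).trans (subset_tsupport η)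

end TestFunctions

/-! ### Weak gradients: approximation, uniqueness, and the chain rule for compactly supported `C¹`
maps. -/

theorem IsH10.exists_seq {u : RSpace N → CSpace m} {Du : Fin N → RSpace N → CSpace m}
    (hu : IsH10 Ω u Du) :
    ∃ f : ℕ → RSpace N → CSpace m, (∀ n, IsTestFunction Ω (f n)) ∧
      (∀ᵐ x ∂volume.restrict Ω, Tendsto (fun n => f n x) atTop (𝓝 (u x))) ∧
      ∀ k, Tendsto (fun n => eLpNorm (fun x => partialDeriv k (f n) x - Du k x) 2
        (volume.restrict Ω)) atTop (𝓝 0) := by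
  have hpos : ∀ n : ℕ, (0 : ENNReal) < ((n : ENNReal) + 1)⁻¹ := fun n =>
    ENNReal.inv_pos.2 (by finiteness)
  have hlim : Tendsto (fun n : ℕ => ((n : ENNReal) + 1)⁻¹) atTop (𝓝 0) := by
    have := (ENNReal.tendsto_inv_nat_nhds_zero).comp (tendsto_add_atTop_nat 1)
    refine this.congr fun n => ?_
    simp
  choose f hf hfu hfD using fun n : ℕ => hu.approx _ (hpos n)
  have hu0 : Tendsto (fun n => eLpNorm (f n - u) 2 (volume.restrict Ω)) atTop (𝓝 0) := by
    refine tendsto_of_tendsto_of_tendsto_of_le_of_le tendsto_const_nhds hlim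
      (fun _ => zero_le) fun n => ?_
    rw [eLpNorm_sub_comm]
    exact (hfu n).le
  obtain ⟨ns, hns, hae⟩ := (tendstoInMeasure_of_tendsto_eLpNorm (by norm_num)
    (fun n => ((hf n).memLp 2).1) hu.memLp.1 hu0).exists_seq_tendsto_ae
  refine ⟨fun n => f (ns n), fun n => hf _, hae, fun k => ?_⟩
  have hD0 : Tendsto (fun n => eLpNorm (fun x => partialDeriv k (f n) x - Du k x) 2
      (volume.restrict Ω)) atTop (𝓝 0) := by
    refine tendsto_of_tendsto_of_tendsto_of_le_of_le tendsto_const_nhds hlim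
      (fun _ => zero_le) fun n => ?_
    have h := eLpNorm_sub_comm (partialDeriv k (f n)) (Du k) 2 (volume.restrict Ω)
    exact h.le.trans (hfD n k).le
  exact hD0.comp hns.tendsto_atTop

theorem locallyIntegrableOn_of_memLp_two {u : RSpace N → CSpace m}
    (hu : MemLp u 2 (volume.restrict Ω)) : LocallyIntegrableOn u Ω volume :=
  locallyIntegrableOn_of_locallyIntegrable_restrict (hu.locallyIntegrable (by norm_num))

theorem HasWeakGradient.ae_eq {u u' : RSpace N → CSpace m} {Du Du' : Fin N → RSpace N → CSpace m}
    (hΩ : IsOpen Ω) (h : HasWeakGradient Ω u Du) (h' : HasWeakGradient Ω u' Du')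
    (hu : ∀ x, u x = u' x) (k : Fin N) : Du k =ᵐ[volume.restrict Ω] Du' k := by
  obtain rfl : u = u' := funext hu
  have key := hΩ.ae_eq_zero_of_integral_contDiff_smul_eq_zero (μ := volume)
    ((h.locInt_grad k).sub (h'.locInt_grad k)) ?_
  · rw [EventuallyEq, ae_restrict_iff' hΩ.measurableSet]
    filter_upwards [key] with x hx hxΩ
    exact sub_eq_zero.1 (hx hxΩ)
  · intro η h1 h2 h3
    have hη : IsTestFunction Ω η := ⟨h1, h2, h3⟩
    rw [← setIntegral_eq_integral_of_forall_compl_eq_zero (s := Ω)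
      (fun x hx => by simp [hη.eq_zero hx])]
    simp only [Pi.sub_apply, smul_sub]
    rw [integral_sub (hη.integrableOn_smul (h.locInt_grad k)) (hη.integrableOn_smul (h'.locInt_grad k)), sub_eq_zero,
      ← neg_inj, ← h.integral_eq η hη k, ← h'.integral_eq η hη k]

/-- Integrate by parts with test functions `f n → u` and split `∂f n = (∂f n - Du) + Du` inside
`DG(f n)`. The first part tends to `0` in `L¹` because `DG` is bounded; the second converges by
dominated convergence, since `DG(f n) → DG(u)` almost everywhere. -/
theorem IsH10.hasWeakGradient_comp {u : RSpace N → CSpace m} {Du : Fin N → RSpace N → CSpace m}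
    (hu : IsH10 Ω u Du) {G : CSpace m → CSpace m} (hG : ContDiff ℝ 1 G)
    (hGc : HasCompactSupport G) :
    HasWeakGradient Ω (fun x => G (u x)) (fun k x => fderiv ℝ G (u x) (Du k x)) := by
  obtain ⟨f, hf, hfu, hfL⟩ := hu.exists_seq
  have hG' : Continuous (fderiv ℝ G) := hG.continuous_fderiv (by simp)
  obtain ⟨B, hB⟩ := hGc.exists_bound_of_continuous hG.continuous
  obtain ⟨M, hM⟩ := (hGc.fderiv ℝ).exists_bound_of_continuous hG'
  have hGu : AEStronglyMeasurable (fun x => G (u x)) (volume.restrict Ω) :=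
    hG.continuous.comp_aestronglyMeasurable hu.memLp.1
  have hDGu : AEStronglyMeasurable (fun x => fderiv ℝ G (u x)) (volume.restrict Ω) :=
    hG'.comp_aestronglyMeasurable hu.memLp.1
  have happ : ∀ {L : RSpace N → (CSpace m →L[ℝ] CSpace m)} {g : RSpace N → CSpace m},
      AEStronglyMeasurable L (volume.restrict Ω) → AEStronglyMeasurable g (volume.restrict Ω) →
      AEStronglyMeasurable (fun x => L x (g x)) (volume.restrict Ω) := fun {L g} hL hg =>
    (isBoundedBilinearMap_apply (𝕜 := ℝ)).continuous.comp_aestronglyMeasurable (hL.prodMk hg)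
  refine ⟨?_, fun k => ?_, fun η hη k => ?_⟩
  · have : MemLp (fun x => G (u x)) ⊤ (volume.restrict Ω) :=
      ⟨hGu, by
      rw [eLpNorm_exponent_top]
      exact eLpNormEssSup_lt_top_of_ae_bound (ae_of_all _ fun x => hB _)⟩
    exact locallyIntegrableOn_of_locallyIntegrable_restrict (this.locallyIntegrable le_top)
  · refine locallyIntegrableOn_of_memLp_two ?_
    refine (hu.memLp_grad k).of_le_mul (c := M) (happ hDGu (hu.memLp_grad k).1) ?_
    exact ae_of_all _ fun x => (ContinuousLinearMap.le_opNorm _ _).trans (by gcongr; exact hM _)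
  have h1 : Tendsto (fun n => ∫ x in Ω, partialDeriv k η x • G (f n x)) atTop
      (𝓝 (∫ x in Ω, partialDeriv k η x • G (u x))) := by
    refine tendsto_integral_of_dominated_convergence (fun x => ‖partialDeriv k η x‖ * B) ?_ ?_ ?_ ?_
    · intro n
      exact ((hη.continuous_partialDeriv k).smul
        (hG.continuous.comp (hf n).continuous)).aestronglyMeasurable
    · exact (memLp_one_iff_integrable.1 (hη.memLp_partialDeriv k 1)).norm.mul_const B
    · intro n
      exact ae_of_all _ fun x => by rw [norm_smul]; gcongr; exact hB _
    · filter_upwards [hfu] with x hx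
      exact ((hG.continuous.tendsto _).comp hx).const_smul _
  have hAm : ∀ n, AEStronglyMeasurable (fun x => η x • fderiv ℝ G (f n x)
      (partialDeriv k (f n) x - Du k x)) (volume.restrict Ω) := fun n =>
    hη.continuous.aestronglyMeasurable.smul (happ
      (hG'.comp (hf n).continuous).aestronglyMeasurable
      (((hf n).continuous_partialDeriv k).aestronglyMeasurable.sub (hu.memLp_grad k).1))
  have hηD : Integrable (fun x => ‖η x‖ * (M * ‖Du k x‖)) (volume.restrict Ω) :=
    (hη.memLp 2).norm.integrable_mul ((hu.memLp_grad k).norm.const_mul M)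
  have hBm : ∀ n, AEStronglyMeasurable (fun x => η x • fderiv ℝ G (f n x) (Du k x))
      (volume.restrict Ω) := fun n =>
    hη.continuous.aestronglyMeasurable.smul (happ
      (hG'.comp (hf n).continuous).aestronglyMeasurable (hu.memLp_grad k).1)
  have hBb : ∀ n x, ‖η x • fderiv ℝ G (f n x) (Du k x)‖ ≤ ‖η x‖ * (M * ‖Du k x‖) := fun n x => by
    rw [norm_smul]
    gcongr
    exact (ContinuousLinearMap.le_opNorm _ _).trans (by gcongr; exact hM _)
  have hAn : ∀ n, eLpNorm (fun x => η x • fderiv ℝ G (f n x)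
      (partialDeriv k (f n) x - Du k x)) 1 (volume.restrict Ω) ≤
      (‖M‖ₑ * eLpNorm η 2 (volume.restrict Ω)) *
        eLpNorm (fun x => partialDeriv k (f n) x - Du k x) 2 (volume.restrict Ω) := fun n => by
    have h := eLpNorm_smul_le_mul_eLpNorm (p := 2) (q := 2) (r := 1) (μ := volume.restrict Ω)
      (((hf n).continuous_partialDeriv k).aestronglyMeasurable.sub (hu.memLp_grad k).1)
      (hη.continuous.aestronglyMeasurable.const_smul M)
    rw [eLpNorm_const_smul] at h
    refine le_trans (eLpNorm_mono fun x => ?_) h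
    have hM0 : 0 ≤ M := (norm_nonneg _).trans (hM 0)
    simp only [Pi.smul_apply', Pi.smul_apply, Pi.sub_apply, norm_smul, smul_eq_mul, norm_mul,
      Real.norm_of_nonneg hM0]
    rw [mul_comm M, mul_assoc]
    gcongr
    exact (ContinuousLinearMap.le_opNorm _ _).trans (by gcongr; exact hM _)
  have hAfin : ∀ n, Integrable (fun x => η x • fderiv ℝ G (f n x)
      (partialDeriv k (f n) x - Du k x)) (volume.restrict Ω) := fun n => by
    refine memLp_one_iff_integrable.1 ⟨hAm n, (hAn n).trans_lt ?_⟩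
    exact ENNReal.mul_lt_top (ENNReal.mul_lt_top (by simp) (hη.memLp 2).2)
      (((hf n).memLp_partialDeriv k 2).sub (hu.memLp_grad k)).2
  have hA : Tendsto (fun n => ∫ x in Ω, η x • fderiv ℝ G (f n x)
      (partialDeriv k (f n) x - Du k x)) atTop (𝓝 0) := by
    have h0 : ∫ x in Ω, (0 : CSpace m) = 0 := by simp
    rw [← h0]
    refine tendsto_integral_of_L1' _ aestronglyMeasurable_const (Eventually.of_forall hAfin) ?_
    have hlim := ENNReal.Tendsto.const_mul (hfL k)
      (a := ‖M‖ₑ * eLpNorm η 2 (volume.restrict Ω))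
      (Or.inr (ENNReal.mul_lt_top (by simp) (hη.memLp 2).2).ne)
    rw [mul_zero] at hlim
    refine tendsto_of_tendsto_of_tendsto_of_le_of_le tendsto_const_nhds hlim
      (fun _ => zero_le) fun n => ?_
    have h := hAn n
    simpa only [Pi.sub_def, sub_zero] using h
  have hBt : Tendsto (fun n => ∫ x in Ω, η x • fderiv ℝ G (f n x) (Du k x)) atTop
      (𝓝 (∫ x in Ω, η x • fderiv ℝ G (u x) (Du k x))) := by
    refine tendsto_integral_of_dominated_convergence _ hBm hηD
      (fun n => ae_of_all _ (hBb n)) ?_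
    filter_upwards [hfu] with x hx
    have hc : Continuous fun y => fderiv ℝ G y (Du k x) := hG'.clm_apply continuous_const
    exact ((hc.tendsto _).comp hx).const_smul _
  have hsum := (hA.add hBt).neg
  rw [zero_add] at hsum
  refine tendsto_nhds_unique h1 (hsum.congr fun n => ?_)
  rw [integral_partialDeriv_smul_comp hG (hf n) hη k, ← integral_add (hAfin n)
    (hηD.mono' (hBm n) (ae_of_all _ (hBb n)))]
  congr 1
  refine integral_congr_ae (ae_of_all _ fun x => ?_)
  simp only [← smul_add, ← map_add, sub_add_cancel]

/-! ### Truncations that vanish near `0` and `∞`. -/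

section Truncation

variable {E : Type*} [NormedAddCommGroup E] [InnerProductSpace ℝ E] [FiniteDimensional ℝ E]

/-- A smooth cut-off function on `E`, equal to `1` on the unit ball. -/
noncomputable def unitBump (E : Type*) [NormedAddCommGroup E] [InnerProductSpace ℝ E] :
    ContDiffBump (0 : E) := ⟨1, 2, one_pos, one_lt_two⟩

/-- A smooth compactly supported vector field on `E`, equal to the identity on the unit ball. -/
noncomputable def cutoffId (z : E) : E := unitBump E z • z

theorem contDiff_cutoffId : ContDiff ℝ 1 (cutoffId : E → E) :=
  (unitBump E).contDiff.smul contDiff_id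

theorem cutoffId_of_norm_le {z : E} (hz : ‖z‖ ≤ 1) : cutoffId z = z := by
  rw [cutoffId, (unitBump E).one_of_mem_closedBall (by simpa [unitBump] using hz), one_smul]

theorem cutoffId_of_two_le {z : E} (hz : 2 ≤ ‖z‖) : cutoffId z = 0 := by
  rw [cutoffId, (unitBump E).zero_of_le_dist (by simpa [unitBump] using hz), zero_smul]

theorem norm_cutoffId_le (z : E) : ‖cutoffId z‖ ≤ ‖z‖ := by
  rw [cutoffId, norm_smul, Real.norm_of_nonneg (unitBump E).nonneg]
  exact mul_le_of_le_one_left (norm_nonneg _) (unitBump E).le_one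

theorem hasCompactSupport_cutoffId : HasCompactSupport (cutoffId : E → E) :=
  HasCompactSupport.intro (isCompact_closedBall 0 2) fun z hz =>
    cutoffId_of_two_le (by simpa using (not_le.1 (mt mem_closedBall_zero_iff.2 hz)).le)

theorem fderiv_cutoffId_of_norm_lt {z : E} (hz : ‖z‖ < 1) :
    fderiv ℝ cutoffId z = ContinuousLinearMap.id ℝ E := by
  have h : (cutoffId : E → E) =ᶠ[𝓝 z] id := by
    filter_upwards [continuous_norm.continuousAt.eventually_lt_const hz] with y hy
    exact cutoffId_of_norm_le hy.le
  rw [h.fderiv_eq, fderiv_id]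

theorem fderiv_cutoffId_of_two_lt {z : E} (hz : 2 < ‖z‖) : fderiv ℝ cutoffId z = 0 := by
  have h : (cutoffId : E → E) =ᶠ[𝓝 z] fun _ => 0 := by
    filter_upwards [continuous_norm.continuousAt.eventually_const_lt hz] with y hy
    exact cutoffId_of_two_le hy.le
  rw [h.fderiv_eq, fderiv_fun_const]
  rfl

/-- A truncation of the identity of `E` away from `0` and `∞`. -/
noncomputable def trunc (c : ℝ) (z : E) : E := c • cutoffId (c⁻¹ • z) - c⁻¹ • cutoffId (c • z)

theorem contDiff_trunc (c : ℝ) : ContDiff ℝ 1 (trunc c : E → E) :=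
  ((contDiff_cutoffId.comp (contDiff_const_smul c⁻¹)).const_smul c).sub
    ((contDiff_cutoffId.comp (contDiff_const_smul c)).const_smul c⁻¹)

/-- The outer factors `c` and `c⁻¹` cancel the inner dilations. This is what makes the derivative
bound independent of `c`. -/
theorem fderiv_trunc {c : ℝ} (hc : c ≠ 0) (z : E) :
    fderiv ℝ (trunc c) z = fderiv ℝ cutoffId (c⁻¹ • z) - fderiv ℝ cutoffId (c • z) := by
  have h : ∀ b : ℝ, HasFDerivAt (fun z : E => cutoffId (b • z))
      ((fderiv ℝ cutoffId (b • z)).comp (b • ContinuousLinearMap.id ℝ E)) z := fun b =>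
    ((contDiff_cutoffId.differentiable (by simp) _).hasFDerivAt).comp z
      ((hasFDerivAt_id z).const_smul b)
  have h' : fderiv ℝ (trunc c) z = _ :=
    (((h c⁻¹).const_smul c).sub ((h c).const_smul c⁻¹)).fderiv
  rw [h']
  ext ξ
  simp [smul_smul, hc]

theorem norm_trunc_le {c : ℝ} (hc : 0 < c) (z : E) : ‖trunc c z‖ ≤ 2 * ‖z‖ := by
  refine (norm_sub_le _ _).trans ?_
  have h : ∀ b : ℝ, 0 < b → ‖b • cutoffId (b⁻¹ • z)‖ ≤ ‖z‖ := fun b hb => by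
    have := norm_cutoffId_le (b⁻¹ • z)
    rw [norm_smul, Real.norm_of_nonneg (inv_nonneg.2 hb.le)] at this
    rw [norm_smul, Real.norm_of_nonneg hb.le]
    calc b * ‖cutoffId (b⁻¹ • z)‖ ≤ b * (b⁻¹ * ‖z‖) := by gcongr
      _ = ‖z‖ := by field_simp
  have h1 := h c hc
  have h2 := h c⁻¹ (inv_pos.2 hc)
  rw [inv_inv] at h2
  linarith

theorem trunc_of_norm_le {c : ℝ} (hc : 1 ≤ c) {z : E} (hz : ‖z‖ ≤ c⁻¹) : trunc c z = 0 := by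
  have hc0 : 0 < c := one_pos.trans_le hc
  have h1 : c⁻¹ ≤ 1 := inv_le_one_of_one_le₀ hc
  rw [trunc, cutoffId_of_norm_le, cutoffId_of_norm_le, smul_smul, smul_smul, mul_comm, sub_self]
  · rw [norm_smul, Real.norm_of_nonneg hc0.le, mul_comm, ← le_div_iff₀ hc0, one_div]
    exact hz
  · rw [norm_smul, Real.norm_of_nonneg (inv_nonneg.2 hc0.le)]
    exact mul_le_one₀ h1 (norm_nonneg _) (hz.trans h1)

theorem trunc_of_le_norm {c : ℝ} (hc : 1 ≤ c) {z : E} (hz : 2 * c ≤ ‖z‖) : trunc c z = 0 := by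
  have hc0 : 0 < c := one_pos.trans_le hc
  rw [trunc, cutoffId_of_two_le, cutoffId_of_two_le, smul_zero, smul_zero, sub_self]
  · rw [norm_smul, Real.norm_of_nonneg hc0.le]
    nlinarith
  · rw [norm_smul, Real.norm_of_nonneg (inv_nonneg.2 hc0.le), inv_mul_eq_div, le_div_iff₀ hc0]
    exact hz

@[simp]
theorem trunc_zero (c : ℝ) : trunc c (0 : E) = 0 := by
  simp [trunc, cutoffId]

theorem exists_norm_fderiv_trunc_le (E : Type*) [NormedAddCommGroup E] [InnerProductSpace ℝ E]
    [FiniteDimensional ℝ E] :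
    ∃ M : ℝ, ∀ c : ℝ, 0 < c → ∀ z : E, ‖fderiv ℝ (trunc c) z‖ ≤ M := by
  obtain ⟨M, hM⟩ := (hasCompactSupport_cutoffId (E := E).fderiv ℝ).exists_bound_of_continuous
    (contDiff_cutoffId.continuous_fderiv (by simp))
  refine ⟨M + M, fun c hc z => ?_⟩
  rw [fderiv_trunc hc.ne']
  exact (norm_sub_le _ _).trans (add_le_add (hM _) (hM _))

theorem eventually_trunc_eq {z : E} (hz : z ≠ 0) :
    ∀ᶠ n : ℕ in atTop, trunc ((n : ℝ) + 1) z = z ∧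
      fderiv ℝ (trunc ((n : ℝ) + 1)) z = ContinuousLinearMap.id ℝ E := by
  have hz' : 0 < ‖z‖ := norm_pos_iff.2 hz
  -- Such `n` give `‖z‖ < n + 1` and `2 < (n + 1)‖z‖`: the outer cut-off acts as the identity near
  -- `z` and the inner one is zero there.
  filter_upwards [eventually_ge_atTop (⌈‖z‖⌉₊ + ⌈2 / ‖z‖⌉₊)] with n hn
  have hn' : ((⌈‖z‖⌉₊ : ℕ) : ℝ) + (⌈2 / ‖z‖⌉₊ : ℕ) ≤ n := by exact_mod_cast hn
  have h1 : ‖z‖ < (n : ℝ) + 1 := by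
    have := Nat.le_ceil ‖z‖
    have : (0 : ℝ) ≤ (⌈2 / ‖z‖⌉₊ : ℕ) := Nat.cast_nonneg _
    linarith
  have h2 : 2 / ‖z‖ < (n : ℝ) + 1 := by
    have := Nat.le_ceil (2 / ‖z‖)
    have : (0 : ℝ) ≤ (⌈‖z‖⌉₊ : ℕ) := Nat.cast_nonneg _
    linarith
  have hc0 : (0 : ℝ) < (n : ℝ) + 1 := by positivity
  have h3 : ‖((n : ℝ) + 1)⁻¹ • z‖ < 1 := by
    rw [norm_smul, Real.norm_of_nonneg (inv_nonneg.2 hc0.le), inv_mul_eq_div, div_lt_one hc0]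
    exact h1
  have h4 : 2 < ‖((n : ℝ) + 1) • z‖ := by
    rw [norm_smul, Real.norm_of_nonneg hc0.le]
    exact (div_lt_iff₀ hz').1 h2
  constructor
  · rw [trunc, cutoffId_of_norm_le h3.le, cutoffId_of_two_le h4.le, smul_smul,
      mul_inv_cancel₀ hc0.ne', one_smul, smul_zero, sub_zero]
  · rw [fderiv_trunc hc0.ne', fderiv_cutoffId_of_norm_lt h3, fderiv_cutoffId_of_two_lt h4, sub_zero]

end Truncation

/-! ### Radial maps `y ↦ ψ(|y|) y` and their truncations. -/

section Radial

variable {E : Type*} [NormedAddCommGroup E] [InnerProductSpace ℝ E]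

/-- The derivative at `y` in direction `ξ` of the radial map `y ↦ ψ(|y|) y`, extended by `0`
at `y = 0`. -/
noncomputable def radialDeriv (ψ : ℝ → ℝ) (y ξ : E) : E :=
  open Classical in
  if y = 0 then 0 else ψ ‖y‖ • ξ + (deriv ψ ‖y‖ * (inner ℝ y ξ / ‖y‖)) • y

/-- Profiles `ψ` for which `y ↦ ψ(|y|) y` is a continuous proper map, `C¹` away from `0`, which
vanishes only at `0`. -/
structure IsRadialProfile (ψ : ℝ → ℝ) : Prop where
  pos : ∀ s, 0 < s → 0 < ψ s
  contDiffOn : ContDiffOn ℝ 1 ψ (Set.Ioi 0)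
  tendsto_zero : Tendsto (fun s => s * ψ s) (𝓝[>] 0) (𝓝 0)
  tendsto_atTop : Tendsto (fun s => s * ψ s) atTop atTop

variable {ψ : ℝ → ℝ}

theorem IsRadialProfile.contDiffAt (hψ : IsRadialProfile ψ) {s : ℝ} (hs : 0 < s) :
    ContDiffAt ℝ 1 ψ s :=
  hψ.contDiffOn.contDiffAt (Ioi_mem_nhds hs)

theorem IsRadialProfile.hasFDerivAt (hψ : IsRadialProfile ψ) {y : E} (hy : y ≠ 0) (ξ : E) :
    DifferentiableAt ℝ (fun y : E => ψ ‖y‖ • y) y ∧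
      fderiv ℝ (fun y : E => ψ ‖y‖ • y) y ξ = radialDeriv ψ y ξ := by
  have hs : 0 < ‖y‖ := norm_pos_iff.2 hy
  have h1 : HasFDerivAt (fun y : E => ‖y‖) (‖y‖⁻¹ • innerSL ℝ y) y := by
    have h := (hasStrictFDerivAt_norm_sq y).hasFDerivAt.sqrt (by positivity)
    simp only [Real.sqrt_sq (norm_nonneg _)] at h
    convert h using 1
    ext ξ
    simp
    field_simp
  have h2 := ((hψ.contDiffAt hs).differentiableAt (by simp)).hasDerivAt
  have h3 := (h2.comp_hasFDerivAt y h1).smul (hasFDerivAt_id y)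
  refine ⟨h3.differentiableAt, ?_⟩
  have h4 : fderiv ℝ (fun y : E => ψ ‖y‖ • y) y = _ := h3.fderiv
  rw [h4, radialDeriv, if_neg hy]
  simp [smul_smul, div_eq_inv_mul, mul_comm, mul_left_comm]

theorem IsRadialProfile.radial_ne_zero (hψ : IsRadialProfile ψ) {y : E} (hy : y ≠ 0) :
    ψ ‖y‖ • y ≠ 0 :=
  smul_ne_zero (hψ.pos _ (norm_pos_iff.2 hy)).ne' hy

theorem IsRadialProfile.norm_radial (hψ : IsRadialProfile ψ) (y : E) : ‖ψ ‖y‖ • y‖ = ‖y‖ * ψ ‖y‖ := by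
  by_cases hy : y = 0
  · simp [hy]
  · rw [norm_smul, Real.norm_of_nonneg (hψ.pos _ (norm_pos_iff.2 hy)).le, mul_comm]

theorem IsRadialProfile.contDiffAt_radial (hψ : IsRadialProfile ψ) {y : E} (hy : y ≠ 0) :
    ContDiffAt ℝ 1 (fun y : E => ψ ‖y‖ • y) y :=
  ((hψ.contDiffAt (norm_pos_iff.2 hy)).comp y (contDiffAt_norm ℝ hy)).smul contDiffAt_id

variable [FiniteDimensional ℝ E]

/-- As `s ψ(s) → 0`, a whole neighbourhood of `0` is mapped into the ball where `trunc c` vanishes;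
a singularity of `ψ` at `0` thus disappears after truncation. -/
theorem IsRadialProfile.trunc_eventuallyEq (hψ : IsRadialProfile ψ) {c : ℝ} (hc : 1 ≤ c) :
    (fun y : E => trunc c (ψ ‖y‖ • y)) =ᶠ[𝓝 0] fun _ => 0 := by
  have hc0 : 0 < c⁻¹ := inv_pos.2 (one_pos.trans_le hc)
  have h := hψ.tendsto_zero.eventually_lt_const hc0
  obtain ⟨δ, hδ, h⟩ := mem_nhdsGT_iff_exists_Ioo_subset.1 h
  filter_upwards [Metric.ball_mem_nhds (0 : E) hδ] with y hy
  rw [mem_ball_zero_iff] at hy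
  by_cases hy0 : y = 0
  · simp [hy0]
  · refine trunc_of_norm_le hc ?_
    rw [hψ.norm_radial]
    exact (h ⟨norm_pos_iff.2 hy0, hy⟩).le

theorem IsRadialProfile.contDiff_trunc_radial (hψ : IsRadialProfile ψ) {c : ℝ} (hc : 1 ≤ c) :
    ContDiff ℝ 1 (fun y : E => trunc c (ψ ‖y‖ • y)) := by
  rw [contDiff_iff_contDiffAt]
  intro y
  by_cases hy : y = 0
  · subst hy
    exact contDiffAt_const.congr_of_eventuallyEq (hψ.trunc_eventuallyEq hc)
  · exact (contDiff_trunc c).contDiffAt.comp y (hψ.contDiffAt_radial hy)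

theorem IsRadialProfile.hasCompactSupport_trunc_radial (hψ : IsRadialProfile ψ) {c : ℝ} (hc : 1 ≤ c) :
    HasCompactSupport (fun y : E => trunc c (ψ ‖y‖ • y)) := by
  obtain ⟨R, hR⟩ := (hψ.tendsto_atTop.eventually_ge_atTop (2 * c)).exists_forall_of_atTop
  refine HasCompactSupport.intro (isCompact_closedBall 0 R) fun y hy => ?_
  refine trunc_of_le_norm hc ?_
  rw [hψ.norm_radial]
  exact hR _ (not_le.1 (mt mem_closedBall_zero_iff.2 hy)).le

theorem IsRadialProfile.fderiv_trunc_apply (hψ : IsRadialProfile ψ) {c : ℝ} (hc : 1 ≤ c)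
    (y ξ : E) :
    fderiv ℝ (fun y : E => trunc c (ψ ‖y‖ • y)) y ξ =
      fderiv ℝ (trunc c) (ψ ‖y‖ • y) (radialDeriv ψ y ξ) := by
  by_cases hy : y = 0
  · subst hy
    rw [(hψ.trunc_eventuallyEq hc).fderiv_eq]
    simp [radialDeriv]
  · rw [← (hψ.hasFDerivAt hy ξ).2]
    have h := fderiv_comp (𝕜 := ℝ) (f := fun y : E => ψ ‖y‖ • y) y
      ((contDiff_trunc c).differentiable (by simp) _)
      (hψ.hasFDerivAt hy ξ).1
    exact congrArg (fun L : E →L[ℝ] E => L ξ) h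

end Radial

/-! ### Removal of the truncation, and gradients of radial compositions. -/

theorem tendsto_trunc {E : Type*} [NormedAddCommGroup E]
    [InnerProductSpace ℝ E] [FiniteDimensional ℝ E] (z : E) :
    Tendsto (fun n : ℕ => trunc ((n : ℝ) + 1) z) atTop (𝓝 z) := by
  by_cases hz : z = 0
  · simp [hz]
  · exact tendsto_const_nhds.congr' ((eventually_trunc_eq hz).mono fun n hn => hn.1.symm)

theorem tendsto_fderiv_trunc_apply {E : Type*} [NormedAddCommGroup E]
    [InnerProductSpace ℝ E] [FiniteDimensional ℝ E] {z ξ : E} (h : z = 0 → ξ = 0) :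
    Tendsto (fun n : ℕ => fderiv ℝ (trunc ((n : ℝ) + 1)) z ξ) atTop (𝓝 ξ) := by
  by_cases hz : z = 0
  · simp [h hz]
  · exact tendsto_const_nhds.congr' ((eventually_trunc_eq hz).mono fun n hn => by simp [hn.2])

/-- Measurability passes to the limit from the truncated fields, so none has to be checked for the
radial expressions themselves. -/
theorem aestronglyMeasurable_of_trunc {v : RSpace N → CSpace m}
    {P : Fin N → RSpace N → CSpace m} (hP0 : ∀ k, ∀ᵐ x ∂volume.restrict Ω, v x = 0 → P k x = 0)
    (h : ∀ n : ℕ, HasWeakGradient Ω (fun x => trunc ((n : ℝ) + 1) (v x))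
      (fun k x => fderiv ℝ (trunc ((n : ℝ) + 1)) (v x) (P k x))) :
    AEStronglyMeasurable v (volume.restrict Ω) ∧
      ∀ k, AEStronglyMeasurable (P k) (volume.restrict Ω) := by
  refine ⟨aestronglyMeasurable_of_tendsto_ae atTop (fun n => (h n).locInt.aestronglyMeasurable)
    (ae_of_all _ fun x => tendsto_trunc (v x)), fun k => ?_⟩
  refine aestronglyMeasurable_of_tendsto_ae atTop
    (fun n => ((h n).locInt_grad k).aestronglyMeasurable) ?_
  filter_upwards [hP0 k] with x hx using tendsto_fderiv_trunc_apply hx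

theorem hasWeakGradient_of_trunc {v : RSpace N → CSpace m}
    {P : Fin N → RSpace N → CSpace m} (hv : MemLp v 2 (volume.restrict Ω))
    (hP : ∀ k, MemLp (P k) 2 (volume.restrict Ω))
    (hP0 : ∀ k, ∀ᵐ x ∂volume.restrict Ω, v x = 0 → P k x = 0)
    (h : ∀ n : ℕ, HasWeakGradient Ω (fun x => trunc ((n : ℝ) + 1) (v x))
      (fun k x => fderiv ℝ (trunc ((n : ℝ) + 1)) (v x) (P k x))) :
    HasWeakGradient Ω v P := by
  obtain ⟨M, hM⟩ := exists_norm_fderiv_trunc_le (CSpace m)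
  refine ⟨locallyIntegrableOn_of_memLp_two hv, fun k => locallyIntegrableOn_of_memLp_two (hP k),
    fun η hη k => ?_⟩
  have hpos : ∀ n : ℕ, (0 : ℝ) < (n : ℝ) + 1 := fun n => by positivity
  have h1 : Tendsto (fun n : ℕ => ∫ x in Ω, partialDeriv k η x • trunc ((n : ℝ) + 1) (v x)) atTop
      (𝓝 (∫ x in Ω, partialDeriv k η x • v x)) := by
    refine tendsto_integral_of_dominated_convergence
      (fun x => ‖partialDeriv k η x‖ * (2 * ‖v x‖)) (fun n => ?_) ?_ (fun n => ?_) ?_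
    · exact (hη.continuous_partialDeriv k).aestronglyMeasurable.smul
        (h n).locInt.aestronglyMeasurable
    · exact (hη.memLp_partialDeriv k 2).norm.integrable_mul (hv.norm.const_mul 2)
    · refine ae_of_all _ fun x => ?_
      rw [norm_smul]
      gcongr
      exact norm_trunc_le (hpos n) _
    · exact ae_of_all _ fun x => (tendsto_trunc (v x)).const_smul _
  have h2 : Tendsto (fun n : ℕ => ∫ x in Ω, η x • fderiv ℝ (trunc ((n : ℝ) + 1)) (v x) (P k x))
      atTop (𝓝 (∫ x in Ω, η x • P k x)) := by
    refine tendsto_integral_of_dominated_convergence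
      (fun x => ‖η x‖ * (M * ‖P k x‖)) (fun n => ?_) ?_ (fun n => ?_) ?_
    · exact hη.continuous.aestronglyMeasurable.smul ((h n).locInt_grad k).aestronglyMeasurable
    · exact (hη.memLp 2).norm.integrable_mul ((hP k).norm.const_mul M)
    · refine ae_of_all _ fun x => ?_
      rw [norm_smul]
      gcongr
      exact (ContinuousLinearMap.le_opNorm _ _).trans (by gcongr; exact hM _ (hpos n) _)
    · filter_upwards [hP0 k] with x hx
      exact (tendsto_fderiv_trunc_apply hx).const_smul _
  exact tendsto_nhds_unique h1 (h2.neg.congr fun n => ((h n).integral_eq η hη k).symm)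

theorem IsH10.hasWeakGradient_trunc_radial {u : RSpace N → CSpace m}
    {Du : Fin N → RSpace N → CSpace m} (hu : IsH10 Ω u Du) {ψ : ℝ → ℝ} (hψ : IsRadialProfile ψ)
    (n : ℕ) :
    HasWeakGradient Ω (fun x => trunc ((n : ℝ) + 1) (ψ ‖u x‖ • u x))
      (fun k x => fderiv ℝ (trunc ((n : ℝ) + 1)) (ψ ‖u x‖ • u x)
        (radialDeriv ψ (u x) (Du k x))) := by
  have hc : (1 : ℝ) ≤ (n : ℝ) + 1 := by simp
  have h := hu.hasWeakGradient_comp (hψ.contDiff_trunc_radial hc)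
    (hψ.hasCompactSupport_trunc_radial hc)
  simpa only [hψ.fderiv_trunc_apply hc] using h

theorem isRadialProfile_one : IsRadialProfile fun _ => 1 where
  pos _ _ := one_pos
  contDiffOn := contDiffOn_const
  tendsto_zero := by
    simp only [mul_one]
    exact tendsto_id.mono_left nhdsWithin_le_nhds
  tendsto_atTop := by
    simp only [mul_one]
    exact tendsto_id

/-- The gradient of a Sobolev function vanishes almost everywhere on its zero set. -/
theorem IsH10.grad_eq_zero (hΩ : IsOpen Ω) {u : RSpace N → CSpace m}
    {Du : Fin N → RSpace N → CSpace m} (hu : IsH10 Ω u Du) (k : Fin N) :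
    ∀ᵐ x ∂volume.restrict Ω, u x = 0 → Du k x = 0 := by
  have ht := hu.hasWeakGradient_trunc_radial isRadialProfile_one
  have hd : ∀ k x, radialDeriv (fun _ => 1) (u x) (Du k x) =
      open Classical in if u x = 0 then 0 else Du k x := fun k x => by simp [radialDeriv]
  simp only [one_smul] at ht
  have h0 : ∀ k, ∀ᵐ x ∂volume.restrict Ω, u x = 0 →
      radialDeriv (fun _ => 1) (u x) (Du k x) = 0 := fun k =>
    ae_of_all _ fun x hx => by rw [hd, if_pos hx]
  have hm := (aestronglyMeasurable_of_trunc h0 ht).2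
  -- The field equal to `Du` off the zero set of `u` and to `0` on it is also a weak gradient of
  -- `u`; uniqueness then forces `Du = 0` on the zero set.
  have hG := hasWeakGradient_of_trunc hu.memLp (fun k => (hu.memLp_grad k).of_le (hm k)
    (ae_of_all _ fun x => by rw [hd]; split_ifs <;> simp)) h0 ht
  filter_upwards [hu.weakGradient.ae_eq hΩ hG (fun _ => rfl) k] with x hx hx0
  rw [hx, hd, if_pos hx0]

/-- The truncations of `w` have two weak gradients, one computed from `u` with profile `ψ`, the
other from `w` with profile `1`. Where `w ≠ 0` some truncation has identity derivative, so they
yield the formula; where `w = 0` both sides vanish. -/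
theorem IsH10.grad_radial_eq (hΩ : IsOpen Ω) {u : RSpace N → CSpace m}
    {Du Dw : Fin N → RSpace N → CSpace m} (hu : IsH10 Ω u Du) {ψ : ℝ → ℝ}
    (hψ : IsRadialProfile ψ) (hw : IsH10 Ω (fun x => ψ ‖u x‖ • u x) Dw) (k : Fin N) :
    ∀ᵐ x ∂volume.restrict Ω, Dw k x = radialDeriv ψ (u x) (Du k x) := by
  have h1 := hu.hasWeakGradient_trunc_radial hψ
  have h2 := hw.hasWeakGradient_trunc_radial isRadialProfile_one
  have hae := ae_all_iff.2 fun n => (h1 n).ae_eq hΩ (h2 n) (fun x => by simp) k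
  filter_upwards [hae, hw.grad_eq_zero hΩ k] with x hx hx0
  by_cases hux : u x = 0
  · rw [hx0 (by simp [hux])]
    simp [radialDeriv, hux]
  · have hwx := hψ.radial_ne_zero hux
    obtain ⟨n, hn⟩ := (eventually_trunc_eq hwx).exists
    have := hx n
    simp only [one_smul, hn.2] at this
    simpa [radialDeriv, hwx, hux] using this.symm

theorem IsH10.isH1_radial {u : RSpace N → CSpace m}
    {Du : Fin N → RSpace N → CSpace m} (hu : IsH10 Ω u Du) {ψ : ℝ → ℝ}
    (hψ : IsRadialProfile ψ) {g : RSpace N → ℝ} (hg : Integrable g (volume.restrict Ω))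
    (hvg : ∀ x, ‖ψ ‖u x‖ • u x‖ ^ 2 ≤ g x)
    {d : Fin N → RSpace N → ℝ} (hd : ∀ k, Integrable (d k) (volume.restrict Ω))
    (hvd : ∀ k, ∀ᵐ x ∂volume.restrict Ω, ‖radialDeriv ψ (u x) (Du k x)‖ ^ 2 ≤ d k x) :
    IsH1 Ω (fun x => ψ ‖u x‖ • u x) (fun k x => radialDeriv ψ (u x) (Du k x)) := by
  have ht := hu.hasWeakGradient_trunc_radial hψ
  have h0 : ∀ k, ∀ᵐ x ∂volume.restrict Ω, ψ ‖u x‖ • u x = 0 →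
      radialDeriv ψ (u x) (Du k x) = 0 := fun k => ae_of_all _ fun x hx => by
    have hux : u x = 0 := by
      by_contra hne
      exact hψ.radial_ne_zero hne hx
    simp [radialDeriv, hux]
  obtain ⟨hvm, hPm⟩ := aestronglyMeasurable_of_trunc h0 ht
  have hv : MemLp (fun x => ψ ‖u x‖ • u x) 2 (volume.restrict Ω) :=
    (memLp_two_iff_integrable_sq_norm hvm).2 (hg.mono' (hvm.norm.pow 2)
      (ae_of_all _ fun x => by rw [Real.norm_of_nonneg (by positivity)]; exact hvg x))
  have hP : ∀ k, MemLp (fun x => radialDeriv ψ (u x) (Du k x)) 2 (volume.restrict Ω) := fun k =>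
    (memLp_two_iff_integrable_sq_norm (hPm k)).2 ((hd k).mono' ((hPm k).norm.pow 2)
      ((hvd k).mono fun x hx => by rw [Real.norm_of_nonneg (by positivity)]; exact hx))
  exact ⟨hv, hP, hasWeakGradient_of_trunc hv hP h0 ht⟩

/-! ### Admissible `φ` and the meaning of the bound on `Λ`. -/

variable {φ : ℝ → ℝ}

theorem IsAdmissible.hasStrictDerivAt (hφ : IsAdmissible φ) {s : ℝ} (hs : 0 < s) :
    HasStrictDerivAt φ (deriv φ s) s :=
  (hφ.contDiffOn.contDiffAt (Ioi_mem_nhds hs)).hasStrictDerivAt (by simp)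

theorem IsAdmissible.deriv_mul (hφ : IsAdmissible φ) {s : ℝ} (hs : 0 < s) :
    deriv (fun σ => σ * φ σ) s = φ s + s * deriv φ s := by
  have h : deriv (fun σ => σ * φ σ) s = _ :=
    ((hasDerivAt_id s).mul (hφ.hasStrictDerivAt hs).hasDerivAt).deriv
  rw [h]
  simp

theorem IsAdmissible.add_mul_deriv_pos (hφ : IsAdmissible φ) {s : ℝ} (hs : 0 < s) :
    0 < φ s + s * deriv φ s :=
  hφ.deriv_mul hs ▸ hφ.deriv_pos s hs

theorem IsAdmissible.strictMonoOn (hφ : IsAdmissible φ) :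
    StrictMonoOn (fun σ => σ * φ σ) (Set.Ioi 0) := by
  refine strictMonoOn_of_deriv_pos (convex_Ioi 0)
    (continuousOn_id.mul hφ.contDiffOn.continuousOn) fun s hs => ?_
  rw [interior_Ioi] at hs
  exact hφ.deriv_pos s hs

/-- An increasing map of `(0, ∞)` onto itself must tend to `0` at `0` and to `∞` at `∞`. -/
theorem IsAdmissible.isRadialProfile (hφ : IsAdmissible φ) : IsRadialProfile φ where
  pos := hφ.pos
  contDiffOn := hφ.contDiffOn
  tendsto_zero := by
    have hpos : ∀ᶠ s in 𝓝[>] (0 : ℝ), 0 < s * φ s := by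
      filter_upwards [self_mem_nhdsWithin] with s hs using mul_pos hs (hφ.pos s hs)
    refine tendsto_order.2 ⟨fun a ha => hpos.mono fun s hs => ha.trans hs, fun b hb => ?_⟩
    obtain ⟨t, ht, htb⟩ := hφ.range_eq.symm.subset (Set.mem_Ioi.2 hb)
    filter_upwards [Ioo_mem_nhdsGT (Set.mem_Ioi.1 ht)] with s hs
    rw [← htb]
    exact hφ.strictMonoOn hs.1 ht hs.2
  tendsto_atTop := by
    refine tendsto_atTop.2 fun b => ?_
    obtain ⟨t, ht, htb⟩ := hφ.range_eq.symm.subset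
      (Set.mem_Ioi.2 (lt_max_of_lt_right (one_pos (α := ℝ)) : 0 < max b 1))
    filter_upwards [eventually_ge_atTop t] with s hs
    have : max b 1 ≤ s * φ s := by
      rw [← htb]
      exact hφ.strictMonoOn.monotoneOn ht (lt_of_lt_of_le ht hs) hs
    exact (le_max_left _ _).trans this

theorem IsRadialProfile.sqrt (hφ : IsRadialProfile φ) : IsRadialProfile fun s => √(φ s) where
  pos s hs := Real.sqrt_pos.2 (hφ.pos s hs)
  contDiffOn := hφ.contDiffOn.sqrt fun s hs => (hφ.pos s hs).ne'
  tendsto_zero := by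
    have h : Tendsto (fun s => √(s * (s * φ s))) (𝓝[>] 0) (𝓝 0) := by
      have h0 := ((tendsto_id (α := ℝ) (x := 𝓝 0)).mono_left nhdsWithin_le_nhds).mul
        hφ.tendsto_zero
      rw [zero_mul] at h0
      have h1 := (Real.continuous_sqrt.tendsto 0).comp h0
      rwa [Real.sqrt_zero] at h1
    refine h.congr' ?_
    filter_upwards [self_mem_nhdsWithin] with s hs
    rw [← mul_assoc, Real.sqrt_mul (mul_self_nonneg s), Real.sqrt_mul_self (le_of_lt hs)]
  tendsto_atTop := by
    have h : Tendsto (fun s => √(s * (s * φ s))) atTop atTop :=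
      Real.tendsto_sqrt_atTop.comp (tendsto_id.atTop_mul_atTop₀ hφ.tendsto_atTop)
    refine h.congr' ?_
    filter_upwards [eventually_ge_atTop 0] with s hs
    rw [← mul_assoc, Real.sqrt_mul (mul_self_nonneg s), Real.sqrt_mul_self hs]

theorem IsAdmissible.hasStrictDerivAt_sqrt (hφ : IsAdmissible φ) {s : ℝ} (hs : 0 < s) :
    HasStrictDerivAt (fun s => √(φ s)) (deriv φ s / (2 * √(φ s))) s :=
  (hφ.hasStrictDerivAt hs).sqrt (hφ.pos s hs).ne'

theorem IsAdmissible.hasStrictDerivAt_mul_sqrt (hφ : IsAdmissible φ) {s : ℝ} (hs : 0 < s) :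
    HasStrictDerivAt (fun s => s * √(φ s)) ((2 * φ s + s * deriv φ s) / (2 * √(φ s))) s := by
  have h := (hasStrictDerivAt_id s).mul (hφ.hasStrictDerivAt_sqrt hs)
  have h0 := Real.sqrt_pos.2 (hφ.pos s hs)
  have h1 := Real.mul_self_sqrt (hφ.pos s hs).le
  refine h.congr_deriv ?_
  simp only [id]
  field_simp
  nlinarith

theorem IsAdmissible.two_mul_add_pos (hφ : IsAdmissible φ) {s : ℝ} (hs : 0 < s) :
    0 < 2 * φ s + s * deriv φ s := by
  linarith [hφ.pos s hs, hφ.add_mul_deriv_pos hs]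

theorem IsAdmissible.zeta_mul_sqrt (hφ : IsAdmissible φ) {s : ℝ} (hs : 0 < s) :
    zeta φ (s * √(φ s)) = s := by
  have hmono : StrictMonoOn (fun s => s * √(φ s)) (Set.Ioi 0) := by
    refine strictMonoOn_of_deriv_pos (convex_Ioi 0) (continuousOn_id.mul
      hφ.contDiffOn.continuousOn.sqrt) fun t ht => ?_
    rw [interior_Ioi] at ht
    rw [(hφ.hasStrictDerivAt_mul_sqrt ht).hasDerivAt.deriv]
    exact div_pos (hφ.two_mul_add_pos ht) (by have := Real.sqrt_pos.2 (hφ.pos t ht); positivity)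
  exact hmono.injOn.leftInvOn_invFunOn hs

/-- At `t = s√φ(s)` one has `Λ = tζ'(t)/ζ(t) - 1` with `ζ(t) = s`, and `ζ'(t)` is the reciprocal of
the derivative of `s√φ(s)`. -/
theorem IsAdmissible.Lambda_mul_sqrt (hφ : IsAdmissible φ) {s : ℝ} (hs : 0 < s) :
    Lambda φ (s * √(φ s)) = - (s * deriv φ s) / (2 * φ s + s * deriv φ s) := by
  have h0 := Real.sqrt_pos.2 (hφ.pos s hs)
  have h1 := Real.sq_sqrt (hφ.pos s hs).le
  have h2 := hφ.two_mul_add_pos hs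
  have hd : (2 * φ s + s * deriv φ s) / (2 * √(φ s)) ≠ 0 := by positivity
  have hz := ((hφ.hasStrictDerivAt_mul_sqrt hs).to_local_left_inverse hd
    (g := zeta φ) (by filter_upwards [Ioi_mem_nhds hs] with t ht using
      hφ.zeta_mul_sqrt ht)).hasDerivAt
  have hΘ : deriv (Theta φ) (s * √(φ s)) = _ :=
    (hz.div (hasDerivAt_id _) (mul_pos hs h0).ne').deriv
  rw [Lambda, hΘ, Theta, hφ.zeta_mul_sqrt hs]
  simp only [id]
  field_simp
  rw [h1]
  ring

/-- With `q = sφ'`, `4φ(φ + q) = (2φ + q)² - q² = (1 - Λ²)(2φ + q)²`, which suggests `c = 1 - sup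
Λ²`. -/
theorem IsAdmissible.exists_const_of_iSup_lt (hφ : IsAdmissible φ)
    (hΛ : (⨆ t ∈ Set.Ioi (0 : ℝ), ENNReal.ofReal (Lambda φ t ^ 2)) < 1) :
    ∃ c : ℝ, 0 < c ∧ c ≤ 1 ∧ ∀ s, 0 < s →
      c * (2 * φ s + s * deriv φ s) ^ 2 ≤ 4 * (φ s * (φ s + s * deriv φ s)) := by
  set S := ⨆ t ∈ Set.Ioi (0 : ℝ), ENNReal.ofReal (Lambda φ t ^ 2) with hS
  have hS1 : S.toReal < 1 := by
    simpa using (ENNReal.toReal_lt_toReal hΛ.ne_top ENNReal.one_ne_top).2 hΛ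
  refine ⟨1 - S.toReal, by linarith, by linarith [ENNReal.toReal_nonneg (a := S)], fun s hs => ?_⟩
  have ht : 0 < s * √(φ s) := mul_pos hs (Real.sqrt_pos.2 (hφ.pos s hs))
  have hle : Lambda φ (s * √(φ s)) ^ 2 ≤ S.toReal := by
    refine (ENNReal.ofReal_le_iff_le_toReal hΛ.ne_top).1 ?_
    exact le_iSup₂_of_le (s * √(φ s)) ht le_rfl
  rw [hφ.Lambda_mul_sqrt hs, div_pow, div_le_iff₀ (pow_pos (hφ.two_mul_add_pos hs) 2)] at hle
  nlinarith

/-! ### Pointwise comparison of the two gradient expressions. -/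

section Pointwise

variable {E : Type*} [NormedAddCommGroup E] [InnerProductSpace ℝ E]

theorem IsAdmissible.norm_radialDeriv_sqrt_sq (hφ : IsAdmissible φ) {y : E} (hy : y ≠ 0) (ξ : E) :
    ‖radialDeriv (fun s => √(φ s)) y ξ‖ ^ 2 =
      φ ‖y‖ * ‖ξ‖ ^ 2 + deriv φ ‖y‖ * ‖y‖ * (inner ℝ y ξ / ‖y‖) ^ 2 +
        (‖y‖ * deriv φ ‖y‖) ^ 2 / (4 * φ ‖y‖) * (inner ℝ y ξ / ‖y‖) ^ 2 := by
  have hs : 0 < ‖y‖ := norm_pos_iff.2 hy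
  have h0 := hφ.pos _ hs
  have h1 := Real.sqrt_pos.2 h0
  have h2 := Real.sq_sqrt h0.le
  rw [radialDeriv, if_neg hy, norm_add_sq_real, norm_smul, norm_smul, real_inner_smul_left,
    real_inner_smul_right, (hφ.hasStrictDerivAt_sqrt hs).hasDerivAt.deriv, real_inner_comm ξ y,
    mul_pow, mul_pow, Real.norm_eq_abs, Real.norm_eq_abs, sq_abs, sq_abs, mul_pow, div_pow, h2]
  rw [real_inner_comm]
  field_simp
  rw [h2]
  ring

theorem inner_radialDeriv {y : E} (hy : y ≠ 0) (ξ : E) :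
    inner ℝ ξ (radialDeriv φ y ξ) =
      φ ‖y‖ * ‖ξ‖ ^ 2 + deriv φ ‖y‖ * ‖y‖ * (inner ℝ y ξ / ‖y‖) ^ 2 := by
  have hs : 0 < ‖y‖ := norm_pos_iff.2 hy
  rw [radialDeriv, if_neg hy, inner_add_right, real_inner_smul_right, real_inner_smul_right,
    real_inner_self_eq_norm_sq, real_inner_comm]
  field_simp

theorem IsAdmissible.inner_radialDeriv_le (hφ : IsAdmissible φ) (y ξ : E) :
    inner ℝ ξ (radialDeriv φ y ξ) ≤ ‖radialDeriv (fun s => √(φ s)) y ξ‖ ^ 2 := by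
  by_cases hy : y = 0
  · simp [radialDeriv, hy]
  · rw [hφ.norm_radialDeriv_sqrt_sq hy, inner_radialDeriv hy]
    have h0 := hφ.pos _ (norm_pos_iff.2 hy)
    exact le_add_of_nonneg_right (by positivity)

theorem IsAdmissible.le_inner_radialDeriv (hφ : IsAdmissible φ) {c : ℝ} (hc1 : c ≤ 1)
    (hc : ∀ s, 0 < s → c * (2 * φ s + s * deriv φ s) ^ 2 ≤ 4 * (φ s * (φ s + s * deriv φ s)))
    (y ξ : E) :
    c * ‖radialDeriv (fun s => √(φ s)) y ξ‖ ^ 2 ≤ inner ℝ ξ (radialDeriv φ y ξ) := by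
  by_cases hy : y = 0
  · simp [radialDeriv, hy]
  · rw [hφ.norm_radialDeriv_sqrt_sq hy, inner_radialDeriv hy]
    have hs : 0 < ‖y‖ := norm_pos_iff.2 hy
    have h0 := hφ.pos _ hs
    have hb : (inner ℝ y ξ / ‖y‖) ^ 2 ≤ ‖ξ‖ ^ 2 := by
      rw [div_pow, div_le_iff₀ (by positivity), mul_comm, ← mul_pow]
      exact sq_le_sq' (neg_le_of_abs_le (abs_real_inner_le_norm y ξ)) (real_inner_le_norm y ξ)
    -- After multiplication by `φ`, the gap between the two sides is `h2` (directions orthogonal to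
    -- `y`, using `c ≤ 1`) plus a quarter of the gap in `h1` (the radial direction).
    have h1 := mul_le_mul_of_nonneg_right (hc _ hs) (sq_nonneg (inner ℝ y ξ / ‖y‖))
    have h2 : 0 ≤ (1 - c) * (φ ‖y‖ ^ 2 * (‖ξ‖ ^ 2 - (inner ℝ y ξ / ‖y‖) ^ 2)) :=
      mul_nonneg (by linarith) (mul_nonneg (by positivity) (by linarith))
    set b := inner ℝ y ξ / ‖y‖
    set q := ‖y‖ * deriv φ ‖y‖ with hq
    rw [← mul_le_mul_iff_of_pos_left h0, mul_comm (deriv φ ‖y‖), ← hq]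
    have h3 : φ ‖y‖ * (c * (φ ‖y‖ * ‖ξ‖ ^ 2 + q * b ^ 2 + q ^ 2 / (4 * φ ‖y‖) * b ^ 2)) =
        c * (φ ‖y‖ ^ 2 * ‖ξ‖ ^ 2 + φ ‖y‖ * q * b ^ 2 + q ^ 2 * b ^ 2 / 4) := by
      field_simp
    rw [h3]
    nlinarith

end Pointwise

/-! ### The sesquilinear form, its Laplacian part, and the equivalence. -/

theorem memLp_coord {p : ENNReal} {μ : Measure (RSpace N)} {f : RSpace N → CSpace m}
    (hf : MemLp f p μ) (i : Fin m) : MemLp (fun x => f x i) p μ :=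
  (EuclideanSpace.proj (𝕜 := ℂ) i).lipschitz.comp_memLp (map_zero _) hf

theorem Coefficients.IsBounded.integrable_form {a : Coefficients N m} (ha : a.IsBounded Ω)
    {Du Dw : Fin N → RSpace N → CSpace m} (hu : ∀ k, MemLp (Du k) 2 (volume.restrict Ω))
    (hw : ∀ k, MemLp (Dw k) 2 (volume.restrict Ω)) :
    Integrable (fun x => ∑ h, ∑ k, ∑ i, ∑ j,
      a x h k i j * Du k x j * (starRingEnd ℂ) (Dw h x i)) (volume.restrict Ω) := by
  refine integrable_finsetSum _ fun h _ => integrable_finsetSum _ fun k _ =>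
    integrable_finsetSum _ fun i _ => integrable_finsetSum _ fun j _ => ?_
  have h1 : MemLp (fun x => a x h k i j * Du k x j) 2 (volume.restrict Ω) :=
    (memLp_coord (hu k) j).mul' (ha h k i j)
  exact h1.integrable_mul (memLp_coord (hw h) i).star

theorem integrable_inner_grad {Du Dw : Fin N → RSpace N → CSpace m}
    (hu : ∀ k, MemLp (Du k) 2 (volume.restrict Ω)) (hw : ∀ k, MemLp (Dw k) 2 (volume.restrict Ω))
    (k : Fin N) : Integrable (fun x => inner ℝ (Du k x) (Dw k x)) (volume.restrict Ω) := by
  have h : Integrable (fun x => ‖Du k x‖ * ‖Dw k x‖) (volume.restrict Ω) :=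
    (hu k).norm.integrable_mul (hw k).norm
  exact h.mono' ((hu k).1.inner (hw k).1) (ae_of_all _ fun x => norm_inner_le_norm _ _)

/-- The real inner product on `ℂ^m` is the real part of the Hermitian one, hence exactly what the
coefficients `δ_{hk} δ_{ij}` contribute. -/
theorem laplacian_integrand (κ : ℝ) (a : Coefficients N m)
    (Du Dw : Fin N → RSpace N → CSpace m) (x : RSpace N) :
    (∑ h, ∑ k, ∑ i, ∑ j, (a - (κ : ℂ) • laplacian N m) x h k i j * Du k x j *
      (starRingEnd ℂ) (Dw h x i)).re =
    (∑ h, ∑ k, ∑ i, ∑ j, a x h k i j * Du k x j * (starRingEnd ℂ) (Dw h x i)).re -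
      κ * ∑ k, inner ℝ (Du k x) (Dw k x) := by
  have h1 : ∀ h k i j, (laplacian N m) x h k i j =
      if h = k then if i = j then (1 : ℂ) else 0 else 0 := fun h k i j => by
    by_cases hk : h = k
    · rw [laplacian, if_pos hk, if_pos hk, Matrix.one_apply]
    · rw [laplacian, if_neg hk, if_neg hk, Matrix.zero_apply]
  have h2 : ∀ h k i j, (a - (κ : ℂ) • laplacian N m) x h k i j * Du k x j *
      (starRingEnd ℂ) (Dw h x i) = a x h k i j * Du k x j * (starRingEnd ℂ) (Dw h x i) -
      (κ : ℂ) * (if h = k then if i = j then Du k x j * (starRingEnd ℂ) (Dw h x i)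
        else 0 else 0) := fun h k i j => by
    simp only [Pi.sub_apply, Pi.smul_apply, Matrix.sub_apply, Matrix.smul_apply, h1, smul_eq_mul]
    split_ifs <;> ring
  simp only [h2, Finset.sum_sub_distrib, ← Finset.mul_sum, Complex.sub_re, Complex.re_ofReal_mul]
  congr 2
  have h3 : ∀ h, (∑ k, ∑ i, ∑ j, if h = k then if i = j then
      Du k x j * (starRingEnd ℂ) (Dw h x i) else 0 else 0) =
      ∑ i, Du h x i * (starRingEnd ℂ) (Dw h x i) := fun h => by
    rw [Finset.sum_eq_single h (fun k _ hk => by simp [hk.symm]) (by simp)]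
    simp
  simp only [h3, Complex.re_sum, PiLp.inner_apply]
  refine Finset.sum_congr rfl fun k _ => Finset.sum_congr rfl fun i _ => ?_
  rw [Complex.inner, mul_comm, ← Complex.conj_re]
  simp

theorem form_sub_laplacian {a : Coefficients N m} (ha : a.IsBounded Ω)
    {Du Dw : Fin N → RSpace N → CSpace m} (hu : ∀ k, MemLp (Du k) 2 (volume.restrict Ω))
    (hw : ∀ k, MemLp (Dw k) 2 (volume.restrict Ω)) (κ : ℝ) :
    form Ω (a - (κ : ℂ) • laplacian N m) Du Dw =
      form Ω a Du Dw - κ * ∫ x in Ω, ∑ k, inner ℝ (Du k x) (Dw k x) := by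
  have hlap : (a - (κ : ℂ) • laplacian N m).IsBounded Ω := fun h k i j => by
    refine (ha h k i j).sub ?_
    refine MemLp.const_smul (c := (κ : ℂ)) (f := fun x => laplacian N m x h k i j) ?_
    have : (fun x => laplacian N m x h k i j) = fun _ => laplacian N m 0 h k i j := rfl
    rw [this]
    exact memLp_top_const _
  have hre : ∀ {f : RSpace N → ℂ}, Integrable f (volume.restrict Ω) →
      (∫ x in Ω, f x).re = ∫ x in Ω, (f x).re := fun hf => (integral_re hf).symm
  have hinner : Integrable (fun x => ∑ k, inner ℝ (Du k x) (Dw k x)) (volume.restrict Ω) :=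
    integrable_finsetSum _ fun k _ => integrable_inner_grad hu hw k
  rw [form, form, hre (hlap.integrable_form hu hw), hre (ha.integrable_form hu hw),
    ← integral_const_mul]
  refine Eq.trans ?_ (integral_sub (ha.integrable_form hu hw).re (hinner.const_mul κ))
  exact integral_congr_ae (ae_of_all _ fun x => laplacian_integrand κ a Du Dw x)

/-- Square integrability comes from `|v|² = |u||w|` and `|∂_k v|² ≤ c⁻¹ Re⟨∂_k u, ∂_k w⟩`, both
bounded by products of `L²` functions. -/
theorem IsAdmissible.isH1_sqrt (hΩ : IsOpen Ω) {φ : ℝ → ℝ} (hφ : IsAdmissible φ) {c : ℝ}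
    (hc0 : 0 < c) (hc1 : c ≤ 1)
    (hc : ∀ s, 0 < s → c * (2 * φ s + s * deriv φ s) ^ 2 ≤ 4 * (φ s * (φ s + s * deriv φ s)))
    {u : RSpace N → CSpace m} {Du Dw : Fin N → RSpace N → CSpace m} (hu : IsH10 Ω u Du)
    (hw : IsH10 Ω (fun x => φ ‖u x‖ • u x) Dw) :
    IsH1 Ω (fun x => √(φ ‖u x‖) • u x)
      (fun k x => radialDeriv (fun s => √(φ s)) (u x) (Du k x)) := by
  refine hu.isH1_radial hφ.isRadialProfile.sqrt
    (g := fun x => ‖u x‖ * ‖φ ‖u x‖ • u x‖) (hu.memLp.norm.integrable_mul hw.memLp.norm)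
    (fun x => le_of_eq ?_) (d := fun k x => c⁻¹ * inner ℝ (Du k x) (Dw k x))
    (fun k => (integrable_inner_grad hu.memLp_grad hw.memLp_grad k).const_mul _) fun k => ?_
  · rw [hφ.isRadialProfile.norm_radial, hφ.isRadialProfile.sqrt.norm_radial]
    by_cases hux : u x = 0
    · simp [hux]
    · rw [mul_pow, Real.sq_sqrt (hφ.pos _ (norm_pos_iff.2 hux)).le]
      ring
  · filter_upwards [hu.grad_radial_eq hΩ hφ.isRadialProfile hw k] with x hx
    rw [hx, le_inv_mul_iff₀ hc0]
    exact hφ.le_inner_radialDeriv hc1 hc _ _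

theorem IsH1.integrable_grad_sq {u : RSpace N → CSpace m} {Du : Fin N → RSpace N → CSpace m}
    (hu : IsH1 Ω u Du) : Integrable (fun x => ∑ k, ‖Du k x‖ ^ 2) (volume.restrict Ω) :=
  integrable_finsetSum _ fun k _ =>
    (memLp_two_iff_integrable_sq_norm (hu.memLp_grad k).1).1 (hu.memLp_grad k)

theorem IsAdmissible.isStrictlyDissipative_iff (hΩ : IsOpen Ω) {a : Coefficients N m}
    (ha : a.IsBounded Ω) {φ : ℝ → ℝ} (hφ : IsAdmissible φ)
    (hΛ : (⨆ t ∈ Set.Ioi (0 : ℝ), ENNReal.ofReal (Lambda φ t ^ 2)) < 1) :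
    IsStrictlyDissipative Ω φ a ↔
      ∃ κ : ℝ, 0 < κ ∧ IsDissipative Ω φ (a - (κ : ℂ) • laplacian N m) := by
  obtain ⟨c, hc0, hc1, hc⟩ := hφ.exists_const_of_iSup_lt hΛ
  constructor
  · rintro ⟨κ, hκ, h⟩
    refine ⟨κ, hκ, fun u Du Dw hu hw => ?_⟩
    obtain ⟨Dv, hv, hle⟩ := h u Du Dw hu hw
    -- The given `Dv` is only some weak gradient of `v`; uniqueness identifies it with the explicit
    -- radial one.
    have hv' := hφ.isH1_sqrt hΩ hc0 hc1 hc hu hw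
    rw [form_sub_laplacian ha hu.memLp_grad hw.memLp_grad, sub_nonneg]
    refine le_trans ?_ hle
    refine mul_le_mul_of_nonneg_left ?_ hκ.le
    refine integral_mono_ae (integrable_finsetSum _ fun k _ =>
      integrable_inner_grad hu.memLp_grad hw.memLp_grad k) hv.integrable_grad_sq ?_
    filter_upwards [ae_all_iff.2 fun k => hu.grad_radial_eq hΩ hφ.isRadialProfile hw k,
      ae_all_iff.2 fun k => hv.weakGradient.ae_eq hΩ hv'.weakGradient (fun _ => rfl) k]
      with x h1 h2
    refine Finset.sum_le_sum fun k _ => ?_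
    rw [h1, h2]
    exact hφ.inner_radialDeriv_le _ _
  · rintro ⟨κ, hκ, h⟩
    -- The factor `c` is the loss in the lower pointwise bound; the converse direction keeps the
    -- same `κ`.
    refine ⟨κ * c, mul_pos hκ hc0, fun u Du Dw hu hw => ?_⟩
    have hv := hφ.isH1_sqrt hΩ hc0 hc1 hc hu hw
    refine ⟨_, hv, ?_⟩
    have h0 := h u Du Dw hu hw
    rw [form_sub_laplacian ha hu.memLp_grad hw.memLp_grad, sub_nonneg] at h0
    refine le_trans ?_ h0
    rw [mul_assoc, ← integral_const_mul]
    refine mul_le_mul_of_nonneg_left ?_ hκ.le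
    refine integral_mono_ae (hv.integrable_grad_sq.const_mul c) (integrable_finsetSum _ fun k _ =>
      integrable_inner_grad hu.memLp_grad hw.memLp_grad k) ?_
    filter_upwards [ae_all_iff.2 fun k => hu.grad_radial_eq hΩ hφ.isRadialProfile hw k] with x h1
    rw [Finset.mul_sum]
    refine Finset.sum_le_sum fun k _ => ?_
    rw [h1]
    exact hφ.le_inner_radialDeriv hc1 hc _ _

/-! ### The power case `φ(s) = s^(p-2)`. -/

section Power

variable {p : ℝ}

theorem mul_rpow_sub_two {s : ℝ} (hs : 0 < s) : s * s ^ (p - 2) = s ^ (p - 1) := by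
  rw [mul_comm, ← Real.rpow_add_one hs.ne']
  ring_nf

theorem deriv_mul_rpow {s : ℝ} (hs : 0 < s) :
    deriv (fun σ : ℝ => σ * σ ^ (p - 2)) s = (p - 1) * s ^ (p - 2) := by
  have h : (fun σ : ℝ => σ * σ ^ (p - 2)) =ᶠ[𝓝 s] fun σ => σ ^ (p - 1) := by
    filter_upwards [Ioi_mem_nhds hs] with t ht using mul_rpow_sub_two ht
  rw [h.deriv_eq, (Real.hasDerivAt_rpow_const (Or.inl hs.ne')).deriv]
  ring_nf

theorem deriv_rpow_sub_two {s : ℝ} (hs : 0 < s) :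
    deriv (fun σ : ℝ => σ ^ (p - 2)) s = (p - 2) * s ^ (p - 3) := by
  rw [(Real.hasDerivAt_rpow_const (Or.inl hs.ne')).deriv]
  ring_nf

theorem isAdmissible_rpow (hp : 1 < p) : IsAdmissible fun s => s ^ (p - 2) where
  pos s hs := Real.rpow_pos_of_pos hs _
  contDiffOn := fun s hs =>
    (Real.contDiffAt_rpow_const_of_ne (ne_of_gt hs)).contDiffWithinAt
  deriv_pos s hs := by
    rw [deriv_mul_rpow hs]
    exact mul_pos (by linarith) (Real.rpow_pos_of_pos hs _)
  range_eq := by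
    ext t
    constructor
    · rintro ⟨s, hs, rfl⟩
      exact mul_pos hs (Real.rpow_pos_of_pos hs _)
    · intro ht
      have hs : 0 < t ^ (p - 1)⁻¹ := Real.rpow_pos_of_pos ht _
      refine ⟨t ^ (p - 1)⁻¹, hs, ?_⟩
      simp only []
      rw [mul_rpow_sub_two hs, ← Real.rpow_mul (le_of_lt ht), inv_mul_cancel₀ (by linarith),
        Real.rpow_one]
  behaviour := by
    refine ⟨p - 1, p - 1, p - 2, 1, 2, by linarith, by linarith, by linarith, one_pos,
      one_lt_two, fun s hs => ?_, fun h => ?_, ?_⟩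
    · rw [deriv_mul_rpow hs.1]
      exact ⟨le_rfl, le_rfl⟩
    · simp only [h, Real.rpow_zero]
      exact ⟨⟨1, one_pos, tendsto_const_nhds⟩, by simp⟩
    · rcases le_total 2 p with h | h
      · refine Or.inl fun s hs => ?_
        rw [deriv_rpow_sub_two (by linarith)]
        exact mul_nonneg (by linarith) (Real.rpow_nonneg (by linarith) _)
      · refine Or.inr fun s hs => ?_
        rw [deriv_rpow_sub_two (by linarith)]
        exact mul_nonpos_of_nonpos_of_nonneg (by linarith) (Real.rpow_nonneg (by linarith) _)

theorem Lambda_rpow (hp : 1 < p) {t : ℝ} (ht : 0 < t) :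
    Lambda (fun s => s ^ (p - 2)) t = (2 - p) / p := by
  have hφ := isAdmissible_rpow hp
  -- Here `s√φ(s) = s^(p/2)`, so `t` is attained at `s = t^(2/p)`.
  have hs : 0 < t ^ (2 / p) := Real.rpow_pos_of_pos ht _
  have h1 : t ^ (2 / p) * √((t ^ (2 / p)) ^ (p - 2)) = t := by
    rw [Real.sqrt_eq_rpow, ← Real.rpow_mul ht.le, ← Real.rpow_mul ht.le, ← Real.rpow_add ht]
    have : 2 / p + 2 / p * (p - 2) * (1 / 2) = 1 := by
      field_simp
      ring
    rw [this, Real.rpow_one]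
  have h2 := hφ.Lambda_mul_sqrt hs
  rw [h1] at h2
  set s := t ^ (2 / p)
  rw [h2, deriv_rpow_sub_two hs]
  have h3 : s * ((p - 2) * s ^ (p - 3)) = (p - 2) * s ^ (p - 2) := by
    rw [show p - 2 = (p - 3) + 1 by ring, Real.rpow_add_one hs.ne']
    ring
  have h4 : 0 < s ^ (p - 2) := Real.rpow_pos_of_pos hs _
  rw [h3, show 2 * s ^ (p - 2) + (p - 2) * s ^ (p - 2) = p * s ^ (p - 2) by ring]
  field_simp
  ring

theorem iSup_Lambda_rpow_lt_one (hp : 1 < p) :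
    (⨆ t ∈ Set.Ioi (0 : ℝ), ENNReal.ofReal (Lambda (fun s => s ^ (p - 2)) t ^ 2)) < 1 := by
  refine lt_of_le_of_lt (b := ENNReal.ofReal (((2 - p) / p) ^ 2))
    (iSup₂_le fun t ht => by rw [Lambda_rpow hp ht]) ?_
  rw [ENNReal.ofReal_lt_one, div_pow, div_lt_one (by positivity)]
  -- The inequality `(2 - p)² < p²` amounts to `p > 1`.
  nlinarith

end Power

end FunctionalDissipativity


open FunctionalDissipativity in
theorem corollary3p5 {N m : ℕ} (Ω : Set (RSpace N)) (hΩ : IsOpen Ω) (hΩc : IsConnected Ω)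
    (a : Coefficients N m) (ha : a.IsBounded Ω) :
    (∀ φ : ℝ → ℝ, IsAdmissible φ →
      (⨆ t ∈ Set.Ioi (0 : ℝ), ENNReal.ofReal (Lambda φ t ^ 2)) < 1 →
      (IsStrictlyDissipative Ω φ a ↔
        ∃ κ : ℝ, 0 < κ ∧ IsDissipative Ω φ (a - (κ : ℂ) • laplacian N m))) ∧
    (∀ p : ℝ, 1 < p →
      (IsStrictlyDissipative Ω (fun s => s ^ (p - 2)) a ↔
        ∃ κ : ℝ, 0 < κ ∧
          IsDissipative Ω (fun s => s ^ (p - 2)) (a - (κ : ℂ) • laplacian N m))) :=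
  ⟨fun _ hφ hΛ => hφ.isStrictlyDissipative_iff hΩ ha hΛ, fun _ hp =>
    (isAdmissible_rpow hp).isStrictlyDissipative_iff hΩ ha (iSup_Lambda_rpow_lt_one hp)⟩
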